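/- Let $q\in\mathbb{Q}$ be nonzero, let $m\in\mathbb{Q}$ with $m\neq 0$ and $m\neq q^2$, and let $(x_1,y_1)\in\mathbb{Q}^2$ be a rational point of the curve $$\mathcal{D}_m\colon (x^2-q)(y^2-q)=m.$$ Let $E_m$ be the elliptic curve over $\mathbb{Q}$ given by $W^2=T^3+(4q^2-2m)T^2+m^2T$, and let $f\colon \mathcal{D}_m\dashrightarrow E_m$ be the birational map defined over $\mathbb{Q}$ by $$T=(y_1^2-q)\cdot\frac{2x_1(y^2-q)x+(x_1^2+q)y^2+x_1^2y_1^2-2x_1^2q-y_1^2q}{(y-y_1)^2},\qquad W=T\cdot\frac{2y_1x(q-y^2)+2x_1y(q-y_1^2)}{y^2-y_1^2}.$$ Let $g\in\mathbb{Q}(E_m)$ be the rational function $$g=(x_1^2-q)\cdot\bigl((x\circ f^{-1})^2-q\bigr),$$ and let $[2]\colon E_m\to E_m$ be the multiplication-by-two map. Then there exists a rational function $h\in\mathbb{Q}(E_m)$ such that $$g\circ[2]=h^2 .$$ -/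

import Mathlib

open Polynomial
open scoped WeierstrassCurve.Affine

noncomputable section

/-! ### Rational maps from a curve to a Weierstrass curve, as maps of function fields -/

namespace EllFun

variable {F : Type*} [Field F] (W : WeierstrassCurve.Affine F) {K : Type*} [Field K] [Algebra F K]

theorem equation_baseChange_iff (x y : K) : (W⁄K).Equation x y ↔
    y ^ 2 + algebraMap F K W.a₁ * x * y + algebraMap F K W.a₃ * y =
      x ^ 3 + algebraMap F K W.a₂ * x ^ 2 + algebraMap F K W.a₄ * x + algebraMap F K W.a₆ := by
  rw [WeierstrassCurve.Affine.equation_iff]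
  rfl

/-- Evaluation of polynomial functions on `W` at a point `(x, y)` of `W` with coordinates in `K`. -/
def evalHom (x y : K) (h : (W⁄K).Equation x y) : W.CoordinateRing →ₐ[F] K :=
  AdjoinRoot.liftAlgHom W.polynomial (aeval x) y (by
    have h' := (equation_baseChange_iff W x y).mp h
    simp only [WeierstrassCurve.Affine.polynomial, eval₂_sub, eval₂_add, eval₂_mul, eval₂_pow,
      eval₂_C, eval₂_X, RingHom.coe_coe, map_add, map_mul, map_pow, aeval_X, aeval_C]
    linear_combination h')

/-- The coordinate function `X` in the function field of `W`. -/
def coordX : W.FunctionField := algebraMap W.CoordinateRing _ (AdjoinRoot.of W.polynomial X)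

/-- The coordinate function `Y` in the function field of `W`. -/
def coordY : W.FunctionField := algebraMap W.CoordinateRing _ (AdjoinRoot.root W.polynomial)

theorem equation_coord : (W⁄W.FunctionField).Equation (coordX W) (coordY W) := by
  rw [equation_baseChange_iff]
  have h := AdjoinRoot.eval₂_root W.polynomial
  have hc : ∀ c : F, AdjoinRoot.of W.polynomial (C c) = algebraMap F W.CoordinateRing c :=
    fun c => rfl
  have h' := congrArg (algebraMap W.CoordinateRing W.FunctionField) h
  conv at h' => lhs; arg 2; arg 3; rw [WeierstrassCurve.Affine.polynomial]
  simp only [eval₂_sub, eval₂_add, eval₂_mul, eval₂_pow, eval₂_C, eval₂_X, map_add, map_mul,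
    map_pow, map_sub, map_zero] at h'
  simp only [IsScalarTower.algebraMap_apply F W.CoordinateRing W.FunctionField, ← hc]
  unfold coordX coordY
  linear_combination h'

theorem transcendental_coordX : Transcendental F (coordX W) := by
  rw [transcendental_iff_injective]
  have h : ∀ p : F[X], aeval (coordX W) p =
      algebraMap W.CoordinateRing W.FunctionField (algebraMap F[X] W.CoordinateRing p) := by
    intro p
    have : coordX W = algebraMap F[X] W.FunctionField X := by
      rw [IsScalarTower.algebraMap_apply F[X] W.CoordinateRing W.FunctionField]; rfl
    rw [this, aeval_algebraMap_apply, aeval_X_left_apply,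
      IsScalarTower.algebraMap_apply F[X] W.CoordinateRing W.FunctionField]
  intro p r hpr
  rw [h, h] at hpr
  exact FaithfulSMul.algebraMap_injective _ _ (IsFractionRing.injective _ _ hpr)

variable {W}

theorem evalHom_injective {x y : K} (h : (W⁄K).Equation x y) (hx : Transcendental F x) :
    Function.Injective (evalHom W x y h) := by
  have : Module.Finite F[X] W.CoordinateRing :=
    Module.Finite.of_basis (WeierstrassCurve.Affine.CoordinateRing.basis W)
  change Function.Injective (evalHom W x y h).toRingHom
  rw [RingHom.injective_iff_ker_eq_bot]
  apply Ideal.eq_bot_of_comap_eq_bot (R := F[X])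
  rw [eq_bot_iff]
  intro p hp
  rw [Ideal.mem_comap, RingHom.mem_ker] at hp
  have : aeval x p = 0 := by
    rw [← hp]
    exact (AdjoinRoot.liftAlgHom_of _ _ _ _ p).symm
  exact (transcendental_iff.mp hx) p this

/-- A non-constant rational map `(x, y)` from a curve with function field `K` to `W` acts on
rational functions by composition: this is the resulting embedding of function fields. -/
def comp (x y : K) (h : (W⁄K).Equation x y) (hx : Transcendental F x) :
    W.FunctionField →ₐ[F] K :=
  IsFractionRing.liftAlgHom (evalHom_injective h hx)

theorem comp_coordX (x y : K) (h : (W⁄K).Equation x y) (hx : Transcendental F x) :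
    comp x y h hx (coordX W) = x := by
  unfold comp coordX
  rw [IsFractionRing.liftAlgHom_apply, IsFractionRing.lift_algebraMap]
  change evalHom W x y h _ = x
  unfold evalHom
  rw [AdjoinRoot.liftAlgHom_of, aeval_X]

theorem comp_coordY (x y : K) (h : (W⁄K).Equation x y) (hx : Transcendental F x) :
    comp x y h hx (coordY W) = y := by
  unfold comp coordY
  rw [IsFractionRing.liftAlgHom_apply, IsFractionRing.lift_algebraMap]
  change evalHom W x y h _ = y
  unfold evalHom
  rw [AdjoinRoot.liftAlgHom_root]

theorem two_ne_zero_of_rat (L : Type*) [Field L] [Algebra ℚ L] : (2 : L) ≠ 0 := by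
  have := (_root_.map_ne_zero (algebraMap ℚ L)).mpr (two_ne_zero' ℚ)
  rwa [map_ofNat] at this

theorem aeval_mem (L : IntermediateField F K) {x : K} (hx : x ∈ L) (p : F[X]) :
    aeval x p ∈ L := by
  have : aeval x p = algebraMap L K (aeval (⟨x, hx⟩ : L) p) := by
    rw [← aeval_algebraMap_apply]; rfl
  rw [this]
  exact (aeval (⟨x, hx⟩ : L) p).2

theorem transcendental_of_quartic {t c : K} (a b : F) (ht : Transcendental F t)
    (h : (t ^ 2 - algebraMap F K b) ^ 2 =
      4 * c * (t ^ 3 + algebraMap F K a * t ^ 2 + algebraMap F K b * t)) :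
    Transcendental F c := by
  intro hc
  let L := algebraicClosure F K
  let c' : L := ⟨c, mem_algebraicClosure_iff.mpr hc⟩
  have hint : IsAlgebraic L t := by
    refine ⟨(X ^ 2 - C (algebraMap F L b)) ^ 2 - C (4 * c') *
      (X ^ 3 + C (algebraMap F L a) * X ^ 2 + C (algebraMap F L b) * X), ?_, ?_⟩
    · generalize algebraMap F L b = b
      generalize algebraMap F L a = a
      intro h0
      have := congrArg (fun p => coeff p 4) h0
      have h4 : ((X ^ 2 - C b) ^ 2 - C (4 * c') * (X ^ 3 + C a * X ^ 2 + C b * X) : L[X]) =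
        X ^ 4 + (C (-4 * c') * X ^ 3 + C (-(b + b) - 4 * c' * a) * X ^ 2 + C (- 4 * c' * b) * X
          + C (b ^ 2)) := by
        simp only [C_mul, C_sub, C_neg, C_pow, C_add]
        ring
      simp only [h4, coeff_add, coeff_C_mul, coeff_X_pow, coeff_X, coeff_C] at this
      simp at this
    · have hc' : algebraMap L K c' = c := rfl
      simp only [map_sub, map_add, map_mul, map_pow, aeval_X, aeval_C, map_ofNat, hc',
        ← IsScalarTower.algebraMap_apply F L K]
      linear_combination h
  exact ht (hint.restrictScalars F)

end EllFun

/-! ### The quartic curve and the elliptic curve -/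

/-- The standing data: a nonzero rational `q`, a rational `m` different from `0` and `q²`, and a
rational point `(x₁, y₁)` on the quartic curve `(x² - q)(y² - q) = m`. -/
structure DqDatum where
  q : ℚ
  m : ℚ
  x₁ : ℚ
  y₁ : ℚ
  q_ne_zero : q ≠ 0
  m_ne_zero : m ≠ 0
  m_ne_sq : m ≠ q ^ 2
  point_mem : (x₁ ^ 2 - q) * (y₁ ^ 2 - q) = m

namespace DqDatum

variable (d : DqDatum)

/-- The polynomial `(x² - q)(y² - q) - m` in `ℚ[y][x]`: the inner variable is `y` and the outer
variable is `x`. -/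
def quarticPoly : ℚ[X][X] :=
  (X ^ 2 - C (C d.q)) * C (X ^ 2 - C d.q) - C (C d.m)

/-- The affine coordinate ring `ℚ[x, y] / ((x² - q)(y² - q) - m)` of the quartic curve. -/
abbrev QuarticRing : Type := AdjoinRoot d.quarticPoly

theorem quarticPoly_eq : d.quarticPoly =
    C (X ^ 2 - C d.q) * X ^ 2 + C 0 * X + C (-(C d.q * (X ^ 2 - C d.q)) - C d.m) := by
  simp only [quarticPoly, C_sub, C_neg, C_mul, C_0, C_pow]
  ring

theorem natDegree_quarticPoly : d.quarticPoly.natDegree = 2 := by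
  rw [quarticPoly_eq]
  exact natDegree_quadratic (X_pow_sub_C_ne_zero (by norm_num) _)

theorem irreducible_quarticPoly : Irreducible d.quarticPoly := by
  have hlc : (X ^ 2 - C d.q : ℚ[X]) ≠ 0 := X_pow_sub_C_ne_zero (by norm_num) _
  have hprim : d.quarticPoly.IsPrimitive := by
    intro r hr
    rw [C_dvd_iff_dvd_coeff] at hr
    have h2 := hr 2
    have h0 := hr 0
    rw [quarticPoly_eq] at h2 h0
    generalize (X ^ 2 - C d.q : ℚ[X]) = L at h2 h0
    simp at h2 h0
    have : r ∣ C d.m := by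
      have := dvd_add (h2.mul_left (C d.q)) h0
      rw [← dvd_neg]
      convert this using 1
      ring
    exact isUnit_of_dvd_unit this (isUnit_C.mpr d.m_ne_zero.isUnit)
  rw [hprim.irreducible_iff_irreducible_map_fraction_map (K := FractionRing ℚ[X])]
  set ι := algebraMap ℚ[X] (FractionRing ℚ[X]) with hι
  have hinj : Function.Injective ι := IsFractionRing.injective _ _
  apply irreducible_of_degree_le_three_of_not_isRoot
  · rw [natDegree_map_eq_of_injective hinj, natDegree_quarticPoly]
    simp
  · intro t ht
    rw [IsRoot, eval_map, quarticPoly] at ht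
    simp only [eval₂_sub, eval₂_mul, eval₂_pow, eval₂_X, eval₂_C] at ht
    have hsq : (ι (X ^ 2 - C d.q) * t) ^ 2 =
        ι ((X ^ 2 - C d.q) * (C d.m + C d.q * (X ^ 2 - C d.q))) := by
      simp only [map_mul, map_add]
      linear_combination (ι (X ^ 2 - C d.q)) * ht
    obtain ⟨s, hs⟩ := IsIntegrallyClosed.exists_algebraMap_eq_of_isIntegral_pow (R := ℚ[X])
      (x := ι (X ^ 2 - C d.q) * t) (n := 2) (by norm_num) (by rw [hsq]; exact isIntegral_algebraMap)
    rw [← hs, ← map_pow] at hsq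
    have hs2 := hinj hsq
    have hdeg : s.natDegree ≤ 2 := by
      have h1 : (s ^ 2).natDegree ≤ 4 := by
        rw [hs2]
        compute_degree
      rw [natDegree_pow] at h1
      omega
    rw [eq_quadratic_of_degree_le_two (natDegree_le_iff_degree_le.mp hdeg)] at hs2
    generalize s.coeff 2 = a at hs2
    generalize s.coeff 1 = b at hs2
    generalize s.coeff 0 = c at hs2
    have hev : ∀ v : ℚ, (a * v ^ 2 + b * v + c) ^ 2 = (v ^ 2 - d.q) * (d.m + d.q * (v ^ 2 - d.q)) := by
      intro v
      have := congrArg (eval v) hs2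
      simpa using this
    have e0 := hev 0
    have e1 := hev 1
    have e2 := hev (-1)
    have e3 := hev 2
    have e4 := hev (-2)
    have c4 : a ^ 2 = d.q := by linarith
    have c3 : a * b = 0 := by linarith
    have c2 : 2 * a * c + b ^ 2 = d.m - 2 * d.q ^ 2 := by linarith
    have c0 : c ^ 2 = - d.q * (d.m - d.q ^ 2) := by linarith
    have ha : a ≠ 0 := by
      rintro rfl
      exact d.q_ne_zero (by rw [← c4]; norm_num)
    have hb : b = 0 := by simpa [ha] using c3
    subst hb
    have : d.m ^ 2 = 0 := by
      have h4 : (2 * a * c) ^ 2 = 4 * a ^ 2 * c ^ 2 := by ring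
      rw [show 2 * a * c = d.m - 2 * d.q ^ 2 by linarith, c4, c0] at h4
      linarith
    exact d.m_ne_zero (by simpa using this)

instance : IsDomain d.QuarticRing :=
  AdjoinRoot.isDomain_of_prime d.irreducible_quarticPoly.prime

/-- The function field of the quartic curve. -/
abbrev QuarticField : Type := FractionRing d.QuarticRing

/-- The coordinate function `x` on the quartic curve. -/
def x : d.QuarticField := algebraMap d.QuarticRing _ (AdjoinRoot.root d.quarticPoly)

/-- The coordinate function `y` on the quartic curve. -/
def y : d.QuarticField := algebraMap d.QuarticRing _ (AdjoinRoot.of d.quarticPoly X)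

/-- A rational number as a constant function on the quartic curve. -/
abbrev const (c : ℚ) : d.QuarticField := algebraMap ℚ d.QuarticField c

theorem algebraMap_of (p : ℚ[X]) :
    algebraMap d.QuarticRing d.QuarticField (AdjoinRoot.of d.quarticPoly p) = aeval d.y p := by
  have : d.y = algebraMap ℚ[X] d.QuarticField X := by
    rw [IsScalarTower.algebraMap_apply ℚ[X] d.QuarticRing d.QuarticField]; rfl
  rw [this, aeval_algebraMap_apply, aeval_X_left_apply,
    IsScalarTower.algebraMap_apply ℚ[X] d.QuarticRing d.QuarticField]
  rfl

/-- The functions `1` and `x` are linearly independent over `ℚ[y]`. -/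
theorem eq_zero_of_add_mul_x (a b : ℚ[X]) (h : aeval d.y a + aeval d.y b * d.x = 0) :
    a = 0 ∧ b = 0 := by
  have h1 : algebraMap d.QuarticRing d.QuarticField
      (AdjoinRoot.mk d.quarticPoly (C b * X + C a)) = 0 := by
    rw [← h, ← algebraMap_of, ← algebraMap_of, x, ← map_mul, ← map_add]
    congr 1
    rw [map_add, map_mul, AdjoinRoot.mk_C, AdjoinRoot.mk_C, AdjoinRoot.mk_X]
    ring
  have h2 := (map_eq_zero_iff _ (IsFractionRing.injective d.QuarticRing d.QuarticField)).mp h1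
  rw [AdjoinRoot.mk_eq_zero] at h2
  have h3 : C b * X + C a = 0 := by
    apply eq_zero_of_dvd_of_natDegree_lt h2
    rw [natDegree_quarticPoly]
    exact lt_of_le_of_lt natDegree_linear_le (by norm_num)
  refine ⟨?_, ?_⟩
  · simpa using congrArg (fun p => coeff p 0) h3
  · simpa using congrArg (fun p => coeff p 1) h3

theorem transcendental_y : Transcendental ℚ d.y := by
  rw [transcendental_iff]
  intro p hp
  exact (d.eq_zero_of_add_mul_x p 0 (by rw [hp]; simp)).1

theorem quartic_relation :
    (d.x ^ 2 - d.const d.q) * (d.y ^ 2 - d.const d.q) = d.const d.m := by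
  have h := AdjoinRoot.eval₂_root d.quarticPoly
  have h' := congrArg (algebraMap d.QuarticRing d.QuarticField) h
  conv at h' => lhs; arg 2; arg 3; rw [quarticPoly]
  simp only [eval₂_sub, eval₂_mul, eval₂_pow, eval₂_C, eval₂_X,
    map_sub, map_mul, map_pow, map_zero] at h'
  simp only [algebraMap_of, aeval_C, aeval_X] at h'
  exact sub_eq_zero.mp h'

/-- The elliptic curve `W² = T³ + (4q² - 2m)T² + m²T`. -/
def E : WeierstrassCurve.Affine ℚ where
  a₁ := 0
  a₂ := 4 * d.q ^ 2 - 2 * d.m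
  a₃ := 0
  a₄ := d.m ^ 2
  a₆ := 0

theorem E_Δ_ne_zero : d.E.Δ ≠ 0 := by
  have : d.E.Δ = 256 * d.m ^ 4 * d.q ^ 2 * (d.q ^ 2 - d.m) := by
    simp only [E, WeierstrassCurve.Δ, WeierstrassCurve.b₂, WeierstrassCurve.b₄,
      WeierstrassCurve.b₆, WeierstrassCurve.b₈]
    ring
  rw [this]
  have := sub_ne_zero.mpr d.m_ne_sq.symm
  have := d.m_ne_zero
  have := d.q_ne_zero
  positivity

instance : d.E.IsElliptic := ⟨d.E_Δ_ne_zero.isUnit⟩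

/-! ### The birational map `f` from the quartic curve to the elliptic curve -/

/-- The first coordinate of `f`. -/
def fT : d.QuarticField :=
  d.const (d.y₁ ^ 2 - d.q) *
    ((2 * d.const d.x₁ * (d.y ^ 2 - d.const d.q) * d.x
      + d.const (d.x₁ ^ 2 + d.q) * d.y ^ 2
      + d.const (d.x₁ ^ 2 * d.y₁ ^ 2 - 2 * d.x₁ ^ 2 * d.q - d.y₁ ^ 2 * d.q))
      / (d.y - d.const d.y₁) ^ 2)

/-- The second coordinate of `f`. -/
def fW : d.QuarticField :=
  d.fT *
    ((2 * d.const d.y₁ * d.x * (d.const d.q - d.y ^ 2)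
      + 2 * d.const d.x₁ * d.y * d.const (d.q - d.y₁ ^ 2))
      / (d.y ^ 2 - d.const d.y₁ ^ 2))

theorem y_ne_const (c : ℚ) : d.y - d.const c ≠ 0 := by
  intro h
  have := (d.eq_zero_of_add_mul_x (X - C c) 0 (by simpa using h)).1
  exact X_sub_C_ne_zero c this

theorem y_sq_ne_const (c : ℚ) : d.y ^ 2 - d.const c ≠ 0 := by
  intro h
  have := (d.eq_zero_of_add_mul_x (X ^ 2 - C c) 0 (by simpa using h)).1
  exact X_pow_sub_C_ne_zero (by norm_num) c this

theorem y_sq_sub_ne_zero : d.y ^ 2 - d.const d.y₁ ^ 2 ≠ 0 := by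
  have := d.y_sq_ne_const (d.y₁ ^ 2)
  rwa [const, map_pow] at this

theorem x₁_ne_zero_or : d.x₁ ≠ 0 ∨ d.y₁ ≠ 0 := by
  by_contra! h
  apply d.m_ne_sq
  rw [← d.point_mem, h.1, h.2]
  ring

theorem y₁_sq_ne : d.y₁ ^ 2 - d.q ≠ 0 := by
  intro h
  apply d.m_ne_zero
  rw [← d.point_mem, h, mul_zero]

theorem f_equation_aux {K : Type*} [Field K] {q m x₁ y₁ x y T V : K}
    (hm : (x₁ ^ 2 - q) * (y₁ ^ 2 - q) = m) (h : (x ^ 2 - q) * (y ^ 2 - q) = m)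
    (h1 : y - y₁ ≠ 0) (h2 : y ^ 2 - y₁ ^ 2 ≠ 0)
    (hT : T * (y - y₁) ^ 2 = (y₁ ^ 2 - q) * (2 * x₁ * (y ^ 2 - q) * x + (x₁ ^ 2 + q) * y ^ 2 +
      (x₁ ^ 2 * y₁ ^ 2 - 2 * x₁ ^ 2 * q - y₁ ^ 2 * q)))
    (hV : V * (y ^ 2 - y₁ ^ 2) = 2 * y₁ * x * (q - y ^ 2) + 2 * x₁ * y * (q - y₁ ^ 2)) :
    (T * V) ^ 2 = T ^ 3 + (4 * q ^ 2 - 2 * m) * T ^ 2 + m ^ 2 * T := by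
  have h3 : y + y₁ ≠ 0 := fun h => h2 (by linear_combination (y - y₁) * h)
  suffices hs : T * V ^ 2 = T ^ 2 + (4 * q ^ 2 - 2 * m) * T + m ^ 2 by
    linear_combination T * hs
  obtain ⟨u, hu⟩ : ∃ u, u = x * (y ^ 2 - q) := ⟨_, rfl⟩
  obtain ⟨s, hs⟩ : ∃ s, s = y₁ ^ 2 - q := ⟨_, rfl⟩
  obtain ⟨α, hα⟩ : ∃ α, α = (x₁ ^ 2 + q) * y ^ 2 +
    (x₁ ^ 2 * y₁ ^ 2 - 2 * x₁ ^ 2 * q - y₁ ^ 2 * q) := ⟨_, rfl⟩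
  obtain ⟨β, hβ⟩ : ∃ β, β = 2 * x₁ * y * (q - y₁ ^ 2) := ⟨_, rfl⟩
  have hu2 : u ^ 2 = (y ^ 2 - q) * (m + q * (y ^ 2 - q)) := by
    rw [hu]; linear_combination (y ^ 2 - q) * h
  have hT' : T * (y - y₁) ^ 2 = s * (2 * x₁ * u + α) := by
    rw [hT, hs, hu, hα]; ring
  have hV' : V * (y ^ 2 - y₁ ^ 2) = - 2 * y₁ * u + β := by
    rw [hV, hu, hβ]; ring
  apply mul_right_cancel₀ (pow_ne_zero 4 h1)
  apply mul_right_cancel₀ (pow_ne_zero 2 h3)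
  have key : s * (2 * x₁ * u + α) * (- 2 * y₁ * u + β) ^ 2 =
      (s * (2 * x₁ * u + α)) ^ 2 * (y + y₁) ^ 2
      + (4 * q ^ 2 - 2 * m) * (s * (2 * x₁ * u + α)) * (y - y₁) ^ 2 * (y + y₁) ^ 2
      + m ^ 2 * (y - y₁) ^ 4 * (y + y₁) ^ 2 := by
    subst hs hα hβ hm
    linear_combination (8 * (y₁ ^ 2 - q) * x₁ * y₁ ^ 2 * u + (y₁ ^ 2 - q) *
      (4 * ((x₁ ^ 2 + q) * y ^ 2 + (x₁ ^ 2 * y₁ ^ 2 - 2 * x₁ ^ 2 * q - y₁ ^ 2 * q)) * y₁ ^ 2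
        - 8 * x₁ * y₁ * (2 * x₁ * y * (q - y₁ ^ 2)))
      - 4 * (y₁ ^ 2 - q) ^ 2 * x₁ ^ 2 * (y + y₁) ^ 2) * hu2
  calc T * V ^ 2 * (y - y₁) ^ 4 * (y + y₁) ^ 2
      = (T * (y - y₁) ^ 2) * (V * (y ^ 2 - y₁ ^ 2)) ^ 2 := by ring
    _ = (T * (y - y₁) ^ 2) ^ 2 * (y + y₁) ^ 2
      + (4 * q ^ 2 - 2 * m) * (T * (y - y₁) ^ 2) * (y - y₁) ^ 2 * (y + y₁) ^ 2
      + m ^ 2 * (y - y₁) ^ 4 * (y + y₁) ^ 2 := by rw [hT', hV', key]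
    _ = _ := by ring

/-- The function `W / T` on the quartic curve. -/
def fV : d.QuarticField :=
  (2 * d.const d.y₁ * d.x * (d.const d.q - d.y ^ 2)
      + 2 * d.const d.x₁ * d.y * d.const (d.q - d.y₁ ^ 2)) / (d.y ^ 2 - d.const d.y₁ ^ 2)

theorem fW_eq : d.fW = d.fT * d.fV := rfl

theorem fT_mul : d.fT * (d.y - d.const d.y₁) ^ 2 =
    (d.const d.y₁ ^ 2 - d.const d.q) * (2 * d.const d.x₁ * (d.y ^ 2 - d.const d.q) * d.x
      + (d.const d.x₁ ^ 2 + d.const d.q) * d.y ^ 2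
      + (d.const d.x₁ ^ 2 * d.const d.y₁ ^ 2 - 2 * d.const d.x₁ ^ 2 * d.const d.q
        - d.const d.y₁ ^ 2 * d.const d.q)) := by
  rw [fT, mul_assoc, div_mul_cancel₀ _ (pow_ne_zero 2 (d.y_ne_const _))]
  simp only [const, map_sub, map_add, map_mul, map_pow, map_ofNat]

theorem fV_mul : d.fV * (d.y ^ 2 - d.const d.y₁ ^ 2) =
    2 * d.const d.y₁ * d.x * (d.const d.q - d.y ^ 2)
      + 2 * d.const d.x₁ * d.y * (d.const d.q - d.const d.y₁ ^ 2) := by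
  rw [fV, div_mul_cancel₀ _ d.y_sq_sub_ne_zero]
  simp only [const, map_sub, map_pow]

theorem const_point_mem : (d.const d.x₁ ^ 2 - d.const d.q) * (d.const d.y₁ ^ 2 - d.const d.q) =
    d.const d.m := by
  rw [← d.point_mem]
  simp only [const, map_sub, map_mul, map_pow]

theorem f_equation : (d.E⁄d.QuarticField).Equation d.fT d.fW := by
  rw [EllFun.equation_baseChange_iff]
  have := f_equation_aux d.const_point_mem d.quartic_relation (d.y_ne_const _) d.y_sq_sub_ne_zero
    d.fT_mul d.fV_mul
  simp only [E, map_zero, map_sub, map_mul, map_pow, map_ofNat]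
  rw [fW_eq]
  linear_combination this

theorem const_y₁_sq_ne : d.const d.y₁ ^ 2 - d.const d.q ≠ 0 := by
  have := (map_ne_zero (algebraMap ℚ d.QuarticField)).mpr d.y₁_sq_ne
  rwa [map_sub, map_pow] at this

theorem fT_ne_zero : d.fT ≠ 0 := by
  intro h0
  have h := d.fT_mul
  rw [h0, zero_mul] at h
  have h1 := (mul_eq_zero.mp h.symm).resolve_left d.const_y₁_sq_ne
  have h2 := d.eq_zero_of_add_mul_x
    (C (d.x₁ ^ 2 + d.q) * X ^ 2 + C (d.x₁ ^ 2 * d.y₁ ^ 2 - 2 * d.x₁ ^ 2 * d.q - d.y₁ ^ 2 * d.q))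
    (C (2 * d.x₁) * (X ^ 2 - C d.q)) (by
      simp only [map_add, map_mul, map_sub, map_pow, aeval_X, aeval_C, map_ofNat]
      linear_combination h1)
  have hx : d.x₁ = 0 := by
    have := (mul_eq_zero.mp h2.2).resolve_right (X_pow_sub_C_ne_zero (by norm_num) _)
    simpa using this
  have := congrArg (fun p => coeff p 2) h2.1
  simp only [coeff_add, coeff_C_mul, coeff_X_pow, coeff_C, hx] at this
  exact d.q_ne_zero (by simpa using this)

/-- The denominator in the formula for `y` in terms of the coordinates of `f`. -/
def yDen : d.QuarticField :=
  d.const d.x₁ * (d.const d.y₁ ^ 2 - d.const d.q) * d.fV + d.const d.y₁ * d.fT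
    - (d.const d.y₁ ^ 2 - d.const d.q) * d.const d.y₁ * (d.const d.x₁ ^ 2 + d.const d.q)

/-- The numerator in the formula for `y` in terms of the coordinates of `f`. -/
def yNum : d.QuarticField :=
  - d.const d.x₁ * d.const d.y₁ * (d.const d.y₁ ^ 2 - d.const d.q) * d.fV
    + d.const d.y₁ ^ 2 * d.fT - (d.const d.y₁ ^ 2 - d.const d.q) *
      (d.const d.x₁ ^ 2 * d.const d.y₁ ^ 2 - 2 * d.const d.x₁ ^ 2 * d.const d.q
        - d.const d.y₁ ^ 2 * d.const d.q)

theorem y_mul_yDen : d.y * d.yDen = d.yNum := by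
  apply mul_right_cancel₀ (d.y_ne_const d.y₁)
  unfold yDen yNum
  linear_combination d.const d.x₁ * (d.const d.y₁ ^ 2 - d.const d.q) * d.fV_mul
    + d.const d.y₁ * d.fT_mul

theorem yDen_ne_zero : d.yDen ≠ 0 := by
  intro h0
  have hB := d.y_mul_yDen
  rw [h0, mul_zero] at hB
  have h1 : d.const d.x₁ * d.const d.y₁ * d.fV =
      d.const d.q * (d.const d.x₁ ^ 2 + d.const d.y₁ ^ 2) := by
    apply mul_left_cancel₀ d.const_y₁_sq_ne
    apply mul_left_cancel₀ (EllFun.two_ne_zero_of_rat d.QuarticField)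
    unfold yDen at h0
    unfold yNum at hB
    linear_combination d.const d.y₁ * h0 + hB
  have h2 := d.eq_zero_of_add_mul_x
    (C (d.q * (d.x₁ ^ 2 + d.y₁ ^ 2)) * (X ^ 2 - C (d.y₁ ^ 2))
      - C (2 * d.x₁ ^ 2 * d.y₁ * (d.q - d.y₁ ^ 2)) * X)
    (C (2 * d.x₁ * d.y₁ ^ 2) * (X ^ 2 - C d.q)) (by
      simp only [map_add, map_mul, map_sub, map_pow, aeval_X, aeval_C, map_ofNat]
      linear_combination d.const d.x₁ * d.const d.y₁ * d.fV_mul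
        - (d.y ^ 2 - d.const d.y₁ ^ 2) * h1)
  have h3 := (mul_eq_zero.mp h2.2).resolve_right (X_pow_sub_C_ne_zero (by norm_num) _)
  have h3' : d.x₁ = 0 ∨ d.y₁ = 0 := by simpa using h3
  have e0 := congrArg (eval 0) h2.1
  have e1 := congrArg (eval 1) h2.1
  simp only [eval_sub, eval_mul, eval_C, eval_pow, eval_X, eval_zero] at e0 e1
  have h4 : 2 * d.x₁ ^ 2 * d.y₁ * (d.q - d.y₁ ^ 2) = 0 := by
    rcases h3' with h | h <;> rw [h] <;> ring
  have h5 : d.q * (d.x₁ ^ 2 + d.y₁ ^ 2) = 0 := by linear_combination e1 - e0 + h4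
  have h6 := (mul_eq_zero.mp h5).resolve_left d.q_ne_zero
  have h7 : d.x₁ = 0 := by nlinarith [sq_nonneg d.x₁, sq_nonneg d.y₁]
  have h8 : d.y₁ = 0 := by nlinarith [sq_nonneg d.x₁, sq_nonneg d.y₁]
  rcases d.x₁_ne_zero_or with h | h
  · exact h h7
  · exact h h8

theorem transcendental_fT : Transcendental ℚ d.fT := by
  intro hT
  let L := algebraicClosure ℚ d.QuarticField
  have hc : ∀ c : ℚ, d.const c ∈ L := fun c => L.algebraMap_mem c
  have h2 : (2 : d.QuarticField) ∈ L := by have := hc 2; rwa [const, map_ofNat] at this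
  have hTL : d.fT ∈ L := mem_algebraicClosure_iff.mpr hT
  have hWL : d.fW ∈ L := by
    rw [mem_algebraicClosure_iff]
    apply IsAlgebraic.of_pow (n := 2) (by norm_num)
    have := (EllFun.equation_baseChange_iff _ _ _).mp d.f_equation
    simp only [E, map_zero, zero_mul, add_zero] at this
    rw [this, ← mem_algebraicClosure_iff]
    exact add_mem (add_mem (pow_mem hTL 3) (mul_mem (hc _) (pow_mem hTL 2))) (mul_mem (hc _) hTL)
  have hVL : d.fV ∈ L := by
    have : d.fV = d.fW / d.fT := by rw [fW_eq, mul_div_cancel_left₀ _ d.fT_ne_zero]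
    rw [this]
    exact div_mem hWL hTL
  have hs : d.const d.y₁ ^ 2 - d.const d.q ∈ L := sub_mem (pow_mem (hc _) 2) (hc _)
  have hy : d.y ∈ L := by
    rw [eq_div_of_mul_eq d.yDen_ne_zero d.y_mul_yDen]
    apply div_mem
    · exact sub_mem (add_mem (mul_mem (mul_mem (mul_mem (neg_mem (hc _)) (hc _)) hs) hVL)
        (mul_mem (pow_mem (hc _) 2) hTL)) (mul_mem hs (sub_mem (sub_mem (mul_mem (pow_mem (hc _) 2)
          (pow_mem (hc _) 2)) (mul_mem (mul_mem h2 (pow_mem (hc _) 2)) (hc _)))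
          (mul_mem (pow_mem (hc _) 2) (hc _))))
    · exact sub_mem (add_mem (mul_mem (mul_mem (hc _) hs) hVL) (mul_mem (hc _) hTL))
        (mul_mem (mul_mem hs (hc _)) (add_mem (pow_mem (hc _) 2) (hc _)))
  exact d.transcendental_y (mem_algebraicClosure_iff.mp hy)

/-- Composition with `f`, as a map from the function field of the elliptic curve to the function
field of the quartic curve. -/
def compF : d.E.FunctionField →ₐ[ℚ] d.QuarticField :=
  EllFun.comp d.fT d.fW d.f_equation d.transcendental_fT

/-- The map `f` is birational. -/
theorem compF_bijective : Function.Bijective d.compF := by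
  refine ⟨d.compF.toRingHom.injective, ?_⟩
  let L := d.compF.fieldRange
  have hc : ∀ c : ℚ, d.const c ∈ L := fun c => L.algebraMap_mem c
  have h2 : (2 : d.QuarticField) ∈ L := by have := hc 2; rwa [const, map_ofNat] at this
  have hTL : d.fT ∈ L := ⟨_, EllFun.comp_coordX _ _ _ _⟩
  have hWL : d.fW ∈ L := ⟨_, EllFun.comp_coordY _ _ _ _⟩
  have hVL : d.fV ∈ L := by
    have : d.fV = d.fW / d.fT := by rw [fW_eq, mul_div_cancel_left₀ _ d.fT_ne_zero]
    rw [this]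
    exact div_mem hWL hTL
  have hs : d.const d.y₁ ^ 2 - d.const d.q ∈ L := sub_mem (pow_mem (hc _) 2) (hc _)
  have hy : d.y ∈ L := by
    rw [eq_div_of_mul_eq d.yDen_ne_zero d.y_mul_yDen]
    apply div_mem
    · exact sub_mem (add_mem (mul_mem (mul_mem (mul_mem (neg_mem (hc _)) (hc _)) hs) hVL)
        (mul_mem (pow_mem (hc _) 2) hTL)) (mul_mem hs (sub_mem (sub_mem (mul_mem (pow_mem (hc _) 2)
          (pow_mem (hc _) 2)) (mul_mem (mul_mem h2 (pow_mem (hc _) 2)) (hc _)))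
          (mul_mem (pow_mem (hc _) 2) (hc _))))
    · exact sub_mem (add_mem (mul_mem (mul_mem (hc _) hs) hVL) (mul_mem (hc _) hTL))
        (mul_mem (mul_mem hs (hc _)) (add_mem (pow_mem (hc _) 2) (hc _)))
  have hyq : d.y ^ 2 - d.const d.q ∈ L := sub_mem (pow_mem hy 2) (hc _)
  have hx : d.x ∈ L := by
    rcases d.x₁_ne_zero_or with h | h
    · have h' : d.const d.x₁ ≠ 0 := (_root_.map_ne_zero _).mpr h
      have : d.x = (d.fT * (d.y - d.const d.y₁) ^ 2 - (d.const d.y₁ ^ 2 - d.const d.q) *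
          ((d.const d.x₁ ^ 2 + d.const d.q) * d.y ^ 2
            + (d.const d.x₁ ^ 2 * d.const d.y₁ ^ 2 - 2 * d.const d.x₁ ^ 2 * d.const d.q
            - d.const d.y₁ ^ 2 * d.const d.q))) /
          ((d.const d.y₁ ^ 2 - d.const d.q) * (2 * d.const d.x₁ * (d.y ^ 2 - d.const d.q))) := by
        apply eq_div_of_mul_eq
        · exact mul_ne_zero d.const_y₁_sq_ne
            (mul_ne_zero (mul_ne_zero (EllFun.two_ne_zero_of_rat _) h') (d.y_sq_ne_const _))
        · linear_combination -d.fT_mul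
      rw [this]
      exact div_mem (sub_mem (mul_mem hTL (pow_mem (sub_mem hy (hc _)) 2)) (mul_mem hs (add_mem
        (mul_mem (add_mem (pow_mem (hc _) 2) (hc _)) (pow_mem hy 2)) (sub_mem (sub_mem (mul_mem
          (pow_mem (hc _) 2) (pow_mem (hc _) 2)) (mul_mem (mul_mem h2 (pow_mem (hc _) 2)) (hc _)))
          (mul_mem (pow_mem (hc _) 2) (hc _))))))
        (mul_mem hs (mul_mem (mul_mem h2 (hc _)) hyq))
    · have h' : d.const d.y₁ ≠ 0 := (_root_.map_ne_zero _).mpr h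
      have : d.x = (2 * d.const d.x₁ * d.y * (d.const d.q - d.const d.y₁ ^ 2)
          - d.fV * (d.y ^ 2 - d.const d.y₁ ^ 2)) /
          (2 * d.const d.y₁ * (d.y ^ 2 - d.const d.q)) := by
        apply eq_div_of_mul_eq
        · exact mul_ne_zero (mul_ne_zero (EllFun.two_ne_zero_of_rat _) h') (d.y_sq_ne_const _)
        · linear_combination d.fV_mul
      rw [this]
      exact div_mem (sub_mem (mul_mem (mul_mem (mul_mem h2 (hc _)) hy)
        (sub_mem (hc _) (pow_mem (hc _) 2))) (mul_mem hVL (sub_mem (pow_mem hy 2)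
          (pow_mem (hc _) 2)))) (mul_mem (mul_mem h2 (hc _)) hyq)
  have hring : ∀ a : d.QuarticRing, algebraMap d.QuarticRing d.QuarticField a ∈ L := by
    intro a
    induction a using AdjoinRoot.induction_on with
    | ih p =>
      induction p using Polynomial.induction_on' with
      | add p r hp hr => rw [map_add, map_add]; exact add_mem hp hr
      | monomial n c =>
        rw [← C_mul_X_pow_eq_monomial, map_mul, map_mul, AdjoinRoot.mk_C, map_pow, map_pow,
          AdjoinRoot.mk_X, algebraMap_of]
        exact mul_mem (EllFun.aeval_mem L hy c) (pow_mem hx n)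
  intro z
  obtain ⟨a, b, -, rfl⟩ := IsFractionRing.div_surjective (A := d.QuarticRing) z
  exact div_mem (hring a) (hring b)

/-- Composition with the rational inverse `f⁻¹`. -/
def compFInv : d.QuarticField ≃ₐ[ℚ] d.E.FunctionField :=
  (AlgEquiv.ofBijective d.compF d.compF_bijective).symm

/-- The rational function `g = (x₁² - q) ((x ∘ f⁻¹)² - q)` on the elliptic curve. -/
def g : d.E.FunctionField :=
  algebraMap ℚ _ (d.x₁ ^ 2 - d.q) * (d.compFInv d.x ^ 2 - algebraMap ℚ _ d.q)

/-! ### The duplication map -/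

/-- The coordinate function `T` on the elliptic curve. -/
abbrev T : d.E.FunctionField := EllFun.coordX d.E

/-- The coordinate function `W` on the elliptic curve. -/
abbrev W : d.E.FunctionField := EllFun.coordY d.E

theorem baseChange_Δ_ne_zero : (d.E⁄d.E.FunctionField).Δ ≠ 0 := by
  have : (d.E⁄d.E.FunctionField).Δ = algebraMap ℚ d.E.FunctionField d.E.Δ :=
    WeierstrassCurve.map_Δ d.E (algebraMap ℚ d.E.FunctionField)
  rw [this]
  exact (_root_.map_ne_zero _).mpr d.E_Δ_ne_zero

/-- The generic point of the elliptic curve. -/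
def genericPoint : (d.E⁄d.E.FunctionField).Point :=
  .some d.T d.W ((WeierstrassCurve.Affine.equation_iff_nonsingular_of_Δ_ne_zero
    d.baseChange_Δ_ne_zero).mp (EllFun.equation_coord d.E))

theorem W_sq : d.W ^ 2 = d.T ^ 3 + algebraMap ℚ _ d.E.a₂ * d.T ^ 2 +
    algebraMap ℚ _ d.E.a₄ * d.T := by
  have := (EllFun.equation_baseChange_iff _ _ _).mp (EllFun.equation_coord d.E)
  have h1 : d.E.a₁ = 0 := rfl
  have h3 : d.E.a₃ = 0 := rfl
  have h6 : d.E.a₆ = 0 := rfl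
  rw [h1, h3, h6] at this
  simpa using this

theorem W_ne_zero : d.W ≠ 0 := by
  intro h
  have h1 := d.W_sq
  have : aeval d.T (X ^ 3 + C d.E.a₂ * X ^ 2 + C d.E.a₄ * X) = 0 := by
    simp only [map_add, map_mul, map_pow, aeval_X, aeval_C]
    rw [← h1, h]; ring
  have h2 := (transcendental_iff.mp (EllFun.transcendental_coordX d.E)) _ this
  have := congrArg (fun p => coeff p 3) h2
  simp at this

theorem W_ne_negY : d.W ≠ (d.E⁄d.E.FunctionField).negY d.T d.W := by
  have h1 : (d.E⁄d.E.FunctionField).a₁ = 0 := map_zero (algebraMap ℚ d.E.FunctionField)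
  have h3 : (d.E⁄d.E.FunctionField).a₃ = 0 := map_zero (algebraMap ℚ d.E.FunctionField)
  rw [WeierstrassCurve.Affine.negY, h1, h3]
  intro h
  exact d.W_ne_zero (mul_left_cancel₀ (EllFun.two_ne_zero_of_rat d.E.FunctionField) (by linear_combination h))

open scoped Classical in
/-- The slope of the tangent line at the generic point. -/
def tangentSlope : d.E.FunctionField :=
  (d.E⁄d.E.FunctionField).slope d.T d.T d.W d.W

/-- The first coordinate of the double of the generic point. -/
def dblT : d.E.FunctionField := (d.E⁄d.E.FunctionField).addX d.T d.T d.tangentSlope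

/-- The second coordinate of the double of the generic point. -/
def dblW : d.E.FunctionField := (d.E⁄d.E.FunctionField).addY d.T d.T d.W d.tangentSlope

theorem dbl_equation : (d.E⁄d.E.FunctionField).Equation d.dblT d.dblW := by
  classical
  unfold dblT dblW tangentSlope
  convert WeierstrassCurve.Affine.equation_add (EllFun.equation_coord d.E)
    (EllFun.equation_coord d.E) (fun h => d.W_ne_negY h.2) using 2

open scoped Classical in
/-- `(dblT, dblW)` is the double of the generic point in the group law of the elliptic curve. -/
theorem two_nsmul_genericPoint : 2 • d.genericPoint = .some d.dblT d.dblW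
    ((WeierstrassCurve.Affine.equation_iff_nonsingular_of_Δ_ne_zero
      d.baseChange_Δ_ne_zero).mp d.dbl_equation) := by
  rw [two_nsmul, genericPoint, WeierstrassCurve.Affine.Point.add_self_of_Y_ne d.W_ne_negY]
  rfl

theorem dblT_mul : 4 * d.W ^ 2 * d.dblT = (d.T ^ 2 - algebraMap ℚ _ d.E.a₄) ^ 2 := by
  classical
  have hs : d.tangentSlope * (2 * d.W) =
      3 * d.T ^ 2 + 2 * algebraMap ℚ _ d.E.a₂ * d.T + algebraMap ℚ _ d.E.a₄ := by
    have h1 : (d.E⁄d.E.FunctionField).a₁ = 0 := map_zero (algebraMap ℚ d.E.FunctionField)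
    have h3 : (d.E⁄d.E.FunctionField).a₃ = 0 := map_zero (algebraMap ℚ d.E.FunctionField)
    have hne : (2 * d.W : d.E.FunctionField) ≠ 0 := mul_ne_zero (EllFun.two_ne_zero_of_rat _) d.W_ne_zero
    unfold tangentSlope
    rw [WeierstrassCurve.Affine.slope_of_Y_ne rfl d.W_ne_negY, WeierstrassCurve.Affine.negY, h1, h3,
      show d.W - (-d.W - 0 * d.T - 0) = 2 * d.W by ring, div_mul_cancel₀ _ hne]
    change 3 * d.T ^ 2 + 2 * algebraMap ℚ _ d.E.a₂ * d.T + algebraMap ℚ _ d.E.a₄ - 0 * d.W = _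
    ring
  have hX : d.dblT = d.tangentSlope ^ 2 - algebraMap ℚ _ d.E.a₂ - 2 * d.T := by
    change d.tangentSlope ^ 2 + algebraMap ℚ _ 0 * d.tangentSlope - algebraMap ℚ _ d.E.a₂ - d.T
      - d.T = _
    rw [map_zero]
    ring
  rw [hX]
  linear_combination (d.tangentSlope * (2 * d.W) + 3 * d.T ^ 2 + 2 * algebraMap ℚ _ d.E.a₂ * d.T
    + algebraMap ℚ _ d.E.a₄) * hs - (4 * algebraMap ℚ _ d.E.a₂ + 8 * d.T) * d.W_sq

theorem transcendental_dblT : Transcendental ℚ d.dblT :=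
  EllFun.transcendental_of_quartic d.E.a₂ d.E.a₄ (EllFun.transcendental_coordX d.E) (by
    linear_combination -d.dblT_mul + 4 * d.dblT * d.W_sq)

/-- Composition with the duplication map `[2]`, on rational functions on the elliptic curve. -/
def compDouble : d.E.FunctionField →ₐ[ℚ] d.E.FunctionField :=
  EllFun.comp d.dblT d.dblW d.dbl_equation d.transcendental_dblT

end DqDatum

end

/-! ### The class of `(x₁² - q)(x² - q)` modulo squares on the quartic curve. -/

namespace DqDatum

variable (d : DqDatum)

/-! Modulo squares, `g` is the coordinate `T`, and `T ∘ [2]` is a square; together these give the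
theorem.

The second fact is the duplication formula. The curve has the form `W² = T(T² + aT + b)` with `b =
m²`, so `T ∘ [2] = ((T² - b) / (2W))²` (`dblT_eq_sq`).

For the first fact, multiplying the quartic equations at `(x, y)` and `(x₁, y₁)` gives `(x₁² - q)(x²
- q) · (y₁² - q)(y² - q) = m²`, so the two factors have the same class modulo squares, and it
suffices to treat the one in `y`. Inverting `f` gives `y = yNum / yDen`, with both terms linear in
`T` and `V = W / T`; hence `y² - q` has the class of the norm `yNum² - q yDen²`. The computational
core, `sq_identity_of_equation`, shows that `(y₁² - q) T` times this norm is a perfect square on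
`E`. Thus `(y₁² - q)(y² - q)`, and with it `g`, is `T` times a square (`exists_g_eq_T_mul_sq`).

Since `[2]` acts on functions by a field homomorphism, it carries `g = T k²` to a product of two
squares. -/

theorem sq_identity_of_equation {K : Type*} [Field K] {q m x₁ y₁ T V : K}
    (hm : (x₁ ^ 2 - q) * (y₁ ^ 2 - q) = m)
    (h : T * V ^ 2 = T ^ 2 + (4 * q ^ 2 - 2 * m) * T + m ^ 2) :
    (y₁ ^ 2 - q) * T *
      ((-x₁ * y₁ * (y₁ ^ 2 - q) * V + y₁ ^ 2 * T
          - (y₁ ^ 2 - q) * (x₁ ^ 2 * y₁ ^ 2 - 2 * x₁ ^ 2 * q - y₁ ^ 2 * q)) ^ 2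
        - q * (x₁ * (y₁ ^ 2 - q) * V + y₁ * T - (y₁ ^ 2 - q) * y₁ * (x₁ ^ 2 + q)) ^ 2) =
      ((y₁ ^ 2 - q) * (x₁ * (y₁ ^ 2 - q) * m - x₁ * (y₁ ^ 2 + q) * T + y₁ * (T * V))) ^ 2 := by
  -- Here `V` stands for `W / T`, and `h` is the equation of `E` divided by `T`. The two squares on
  -- the left are those of `yNum` and `yDen`; the root on the right is linear in `T` and `W = TV`.
  subst hm
  -- The multiplier is read off from the `V²` terms: `(y₁² - q)⁴ x₁² T V²` on the left and `(y₁² -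
  -- q)² y₁² T² V²` on the right. Once `T V²` is eliminated through `h`, what remains is a
  -- polynomial identity.
  linear_combination ((y₁ ^ 2 - q) ^ 4 * x₁ ^ 2 - (y₁ ^ 2 - q) ^ 2 * y₁ ^ 2 * T) * h

/-- Up to a constant factor and squares, the norm `yNum² - q yDen²` is the first coordinate of `f`. -/
theorem exists_sq_eq_mul_fT_mul_norm : ∃ r : d.QuarticField,
    (d.const d.y₁ ^ 2 - d.const d.q) * d.fT * (d.yNum ^ 2 - d.const d.q * d.yDen ^ 2) = r ^ 2 := by
  refine ⟨_, sq_identity_of_equation d.const_point_mem (mul_left_cancel₀ d.fT_ne_zero ?_)⟩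
  have h := (EllFun.equation_baseChange_iff _ _ _).mp d.f_equation
  simp only [E, map_zero, map_sub, map_mul, map_pow, map_ofNat] at h
  rw [fW_eq] at h
  apply mul_left_cancel₀ d.fT_ne_zero
  linear_combination d.fT * h

/-- Up to squares, `(x₁² - q)(x² - q)` is the first coordinate of `f`. -/
theorem exists_eq_fT_mul_sq : ∃ k : d.QuarticField,
    d.const (d.x₁ ^ 2 - d.q) * (d.x ^ 2 - d.const d.q) = d.fT * k ^ 2 := by
  obtain ⟨r, hr⟩ := d.exists_sq_eq_mul_fT_mul_norm
  have hy : d.y ^ 2 - d.const d.q ≠ 0 := d.y_sq_ne_const _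
  -- Substituting `yNum = y · yDen` turns the norm into `yDen² (y² - q)`.
  have hr' : (d.const d.y₁ ^ 2 - d.const d.q) * d.fT * (d.yDen ^ 2 * (d.y ^ 2 - d.const d.q)) =
      r ^ 2 := by
    rw [← hr, ← d.y_mul_yDen]
    ring
  have hr0 : r ^ 2 ≠ 0 := by
    rw [← hr']
    exact mul_ne_zero (mul_ne_zero d.const_y₁_sq_ne d.fT_ne_zero)
      (mul_ne_zero (pow_ne_zero 2 d.yDen_ne_zero) hy)
  -- By `hr'`, `T (m yDen / r)² = m² / ((y₁² - q)(y² - q))`, and this equals `(x₁² - q)(x² - q)` by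
  -- the product of the two quartic equations.
  refine ⟨d.const d.m * d.yDen / r, ?_⟩
  rw [div_pow, mul_div_assoc', eq_div_iff hr0, ← hr', const, map_sub, map_pow]
  linear_combination (d.fT * d.yDen ^ 2 * d.const d.m) * d.const_point_mem
    + (d.const d.x₁ ^ 2 - d.const d.q) * (d.const d.y₁ ^ 2 - d.const d.q) * d.fT * d.yDen ^ 2
      * d.quartic_relation

/-! ### Transfer to the elliptic curve along `f⁻¹`. -/

theorem compF_T : d.compF d.T = d.fT := EllFun.comp_coordX _ _ _ _

theorem compFInv_fT : d.compFInv d.fT = d.T := by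
  rw [← compF_T]
  exact (AlgEquiv.ofBijective d.compF d.compF_bijective).symm_apply_apply d.T

/-- The relation on the quartic curve is carried over by the field isomorphism `compFInv`, which
fixes constants and sends `fT` to `T`. -/
theorem exists_g_eq_T_mul_sq : ∃ k : d.E.FunctionField, d.g = d.T * k ^ 2 := by
  obtain ⟨k, hk⟩ := d.exists_eq_fT_mul_sq
  refine ⟨d.compFInv k, ?_⟩
  have h := congrArg d.compFInv hk
  rwa [map_mul, map_mul, map_sub, map_pow, map_pow, AlgEquiv.commutes, AlgEquiv.commutes,
    compFInv_fT] at h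

/-! ### Duplication and the square root of `g ∘ [2]`. -/

/-- With `a₁ = a₃ = a₆ = 0`, the numerator of the duplication formula is the perfect square `(T² -
a₄)²`, and its denominator `4W²` is a square as well. -/
theorem dblT_eq_sq :
    d.dblT = ((d.T ^ 2 - algebraMap ℚ _ d.E.a₄) / (2 * d.W)) ^ 2 := by
  have h2 : (2 * d.W) ^ 2 ≠ 0 :=
    pow_ne_zero 2 (mul_ne_zero (EllFun.two_ne_zero_of_rat _) d.W_ne_zero)
  rw [div_pow, eq_div_iff h2, ← d.dblT_mul]
  ring

theorem compDouble_T : d.compDouble d.T = d.dblT := EllFun.comp_coordX _ _ _ _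

end DqDatum

theorem proposition4 (d : DqDatum) :
    ∃ h : d.E.FunctionField, d.compDouble d.g = h ^ 2 := by
  obtain ⟨k, hk⟩ := d.exists_g_eq_T_mul_sq
  -- The two factors are the square root of `T ∘ [2]` and `k ∘ [2]`, where `g = T k²`.
  refine ⟨(d.T ^ 2 - algebraMap ℚ _ d.E.a₄) / (2 * d.W) * d.compDouble k, ?_⟩
  rw [hk, map_mul, map_pow, d.compDouble_T, d.dblT_eq_sq, mul_pow]
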